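/- Let $\mathbb{H}=\{z\in\mathbb{C}:\operatorname{Im} z>0\}$ and let $f\colon\mathbb{H}\to\mathbb{H}$ be a parabolic holomorphic function whose Denjoy--Wolff point is $\infty$; that is, $f^n\to\infty$ uniformly on compact subsets of $\mathbb{H}$, where $f^n$ is the $n$-th iterate of $f$, and $z/f(z)\to 1$ as $z\to\infty$ non-tangentially in $\mathbb{H}$ (i.e. within each sector $|\operatorname{Re} z|\le C\operatorname{Im} z$, $C>0$). Write $$f(z)=z+\beta+\int_{\mathbb{R}}\frac{1+tz}{t-z}\,d\mu(t),\qquad z\in\mathbb{H},$$ where $\beta\in\mathbb{R}$ and $\mu$ is a positive finite Borel measure on $\mathbb{R}$. Suppose that $\mu$ is symmetric, i.e. $\mu(A)=\mu(-A)$ for every Borel set $A\subset\mathbb{R}$. Say that $f$ is of zero hyperbolic step if there exists $z\in\mathbb{H}$ with $\rho(f^{n+1}(z),f^n(z))\to 0$ as $n\to\infty$, where $\rho(z,w)=|z-w|/|z-\overline{w}|$ is the pseudo-hyperbolic distance of $\mathbb{H}$. (a) If $\int_{\mathbb{R}}t^2\,d\mu(t)<+\infty$, then $f$ is of zero hyperbolic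 step if and only if $\beta=0$. (b) If $\int_{\mathbb{R}}t^2\,d\mu(t)=+\infty$, then $f$ is of zero hyperbolic step, whatever $\beta\in\mathbb{R}$ is. Furthermore, for every $z\in\mathbb{H}$, $f$ is of zero hyperbolic step if and only if $\operatorname{Im}(f^n(z))\to+\infty$ as $n\to\infty$. -/

import Mathlib

open Filter Topology MeasureTheory
open scoped UpperHalfPlane Manifold Pointwise

/-- The sequence of iterates of `f` converges to `∞`, uniformly on compact subsets of `ℍ`:
the point `∞` is the Denjoy-Wolff point of `f`. -/
def HasDenjoyWolffPointInfinity (f : ℍ → ℍ) : Prop :=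
  ∀ K : Set ℍ, IsCompact K → ∀ R : ℝ, ∀ᶠ n : ℕ in atTop, ∀ z ∈ K, R ≤ ‖(f^[n] z : ℂ)‖

/-- `l` is the angular (non-tangential) limit of `h` at `∞`: the function `h` tends to `l` as
`z → ∞` inside each sector `|Re z| ≤ C * Im z`. -/
def HasAngularLimitAtInfinity (h : ℍ → ℂ) (l : ℂ) : Prop :=
  ∀ C : ℝ, 0 < C →
    Tendsto h (comap (fun z : ℍ => ‖(z : ℂ)‖) atTop ⊓ 𝓟 {z : ℍ | |z.re| ≤ C * z.im}) (𝓝 l)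

/-- `f` is a parabolic holomorphic self-map of `ℍ` whose Denjoy-Wolff point is `∞`.
In the disc model with boundary fixed point `τ`, the multiplier `∠lim (g w - τ) / (w - τ)`
becomes `∠lim z / f z` after conjugation by a Möbius map taking `∞` to `τ`; the map is parabolic
when the multiplier is `1`. -/
structure IsParabolicAtInfinity (f : ℍ → ℍ) : Prop where
  holomorphic : MDifferentiable 𝓘(ℂ) 𝓘(ℂ) f
  denjoyWolff : HasDenjoyWolffPointInfinity f
  multiplier_eq_one : HasAngularLimitAtInfinity (fun z => (z : ℂ) / (f z : ℂ)) 1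

/-- The pseudo-hyperbolic distance of the upper half-plane. -/
noncomputable def pseudoHyperbolicDist (z w : ℍ) : ℝ :=
  ‖(z : ℂ) - (w : ℂ)‖ / ‖(z : ℂ) - (starRingEnd ℂ) (w : ℂ)‖

/-- `f` is of zero hyperbolic step. -/
def HasZeroHyperbolicStep (f : ℍ → ℍ) : Prop :=
  ∃ z : ℍ, Tendsto (fun n : ℕ => pseudoHyperbolicDist (f^[n + 1] z) (f^[n] z)) atTop (𝓝 0)

/-- `f z = z + β + ∫ (1 + t z) / (t - z) dμ(t)` on the upper half-plane. -/
def HasParabolicRepresentation (f : ℍ → ℍ) (β : ℝ) (μ : Measure ℝ) : Prop :=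
  ∀ z : ℍ, (f z : ℂ) =
    (z : ℂ) + (β : ℂ) + ∫ t : ℝ, (1 + (t : ℂ) * (z : ℂ)) / ((t : ℂ) - (z : ℂ)) ∂μ

/-- `μ` is symmetric: `μ A = μ (-A)` for every measurable `A`. -/
def IsSymmetricMeasure (μ : Measure ℝ) : Prop :=
  ∀ A : Set ℝ, MeasurableSet A → μ A = μ (-A)

/-! Write P for `poissonMass μ` and x + iy for a point of an orbit. The representation gives y' =
y(1 + P), so heights never decrease, and symmetry of μ gives |x' - x - β| ≤ |x| P. It also yields
Schwarz–Pick, so any two orbits stay within bounded hyperbolic distance and their heights are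
unbounded together.

Unbounded height forces zero step (`tendsto_dist_iterate`): a step bounded below would make P large
enough to keep |x|/y bounded, and on non-tangential orbits parabolicity sends the step to 0. If β =
0, the orbit of i climbs the imaginary axis.

If the second moment is infinite, bounded height would make P summable along the orbit, while |x|
sweeps the half-line with bounded gaps; summing the densities then bounds ∫ t² dμ, a contradiction.
If it is finite and β ≠ 0, an orbit started high enough has uniformly separated real parts, so its
total gain in height is finite. Consecutive differences tend to β ≠ 0 at bounded height, so the step
cannot vanish. -/

/-! ### Kernel bounds and integrability. -/

/-- The integral of `(1 + t ^ 2) / |t - z| ^ 2` with respect to `μ`. -/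
noncomputable def poissonMass (μ : Measure ℝ) (z : ℍ) : ℝ :=
  ∫ t : ℝ, (1 + t ^ 2) / Complex.normSq ((t : ℂ) - z) ∂μ

theorem ofReal_sub_coe_ne_zero (t : ℝ) (z : ℍ) : (t : ℂ) - z ≠ 0 := by
  intro h
  have := congrArg Complex.im h
  simp at this
  exact z.im_ne_zero this

theorem ofReal_sub_conj_coe_ne_zero (t : ℝ) (z : ℍ) : (t : ℂ) - (starRingEnd ℂ) (z : ℂ) ≠ 0 := by
  intro h
  have := congrArg Complex.im h
  simp at this
  exact z.im_ne_zero this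

theorem normSq_ofReal_sub_coe (t : ℝ) (z : ℍ) :
    Complex.normSq ((t : ℂ) - z) = (t - z.re) ^ 2 + z.im ^ 2 := by
  simp [Complex.normSq_apply]; ring

theorem normSq_ofReal_sub_coe_pos (t : ℝ) (z : ℍ) : 0 < Complex.normSq ((t : ℂ) - z) :=
  Complex.normSq_pos.2 (ofReal_sub_coe_ne_zero t z)

theorem poissonDensity_le (t : ℝ) (z : ℍ) :
    (1 + t ^ 2) / Complex.normSq ((t : ℂ) - z) ≤ 2 + (1 + 2 * z.re ^ 2) / z.im ^ 2 := by
  have hy : 0 < z.im ^ 2 := pow_pos z.im_pos 2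
  rw [div_le_iff₀ (normSq_ofReal_sub_coe_pos t z), normSq_ofReal_sub_coe]
  have h1 : 1 + 2 * z.re ^ 2 ≤ (1 + 2 * z.re ^ 2) / z.im ^ 2 * ((t - z.re) ^ 2 + z.im ^ 2) := by
    rw [div_mul_eq_mul_div, le_div_iff₀ hy]
    nlinarith [mul_nonneg (by positivity : (0 : ℝ) ≤ 1 + 2 * z.re ^ 2) (sq_nonneg (t - z.re))]
  nlinarith [sq_nonneg (t - 2 * z.re)]

theorem continuous_poissonDensity (z : ℍ) :
    Continuous fun t : ℝ => (1 + t ^ 2) / Complex.normSq ((t : ℂ) - z) := by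
  refine Continuous.div (by fun_prop) ?_ fun t => (normSq_ofReal_sub_coe_pos t z).ne'
  exact Complex.continuous_normSq.comp (by fun_prop)

theorem poissonDensity_nonneg (t : ℝ) (z : ℍ) :
    0 ≤ (1 + t ^ 2) / Complex.normSq ((t : ℂ) - z) :=
  div_nonneg (by positivity) (Complex.normSq_nonneg _)

theorem poissonMass_nonneg (μ : Measure ℝ) (z : ℍ) : 0 ≤ poissonMass μ z :=
  integral_nonneg fun t => poissonDensity_nonneg t z

section Integrability

variable (μ : Measure ℝ) [IsFiniteMeasure μ]

theorem integrable_poissonDensity (z : ℍ) :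
    Integrable (fun t : ℝ => (1 + t ^ 2) / Complex.normSq ((t : ℂ) - z)) μ := by
  refine Integrable.of_bound (continuous_poissonDensity z).aestronglyMeasurable
    (2 + (1 + 2 * z.re ^ 2) / z.im ^ 2) (ae_of_all _ fun t => ?_)
  rw [Real.norm_of_nonneg (poissonDensity_nonneg t z)]
  exact poissonDensity_le t z

theorem integrable_herglotzKernel (z : ℍ) :
    Integrable (fun t : ℝ => (1 + (t : ℂ) * (z : ℂ)) / ((t : ℂ) - (z : ℂ))) μ := by
  refine Integrable.of_bound (Continuous.aestronglyMeasurable <|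
    Continuous.div (by fun_prop) (by fun_prop) fun t => ofReal_sub_coe_ne_zero t z)
    (‖1 + (z : ℂ) ^ 2‖ / z.im + ‖(z : ℂ)‖) (ae_of_all _ fun t => ?_)
  have h0 := ofReal_sub_coe_ne_zero t z
  have h : (1 + (t : ℂ) * (z : ℂ)) / ((t : ℂ) - (z : ℂ)) =
      (1 + (z : ℂ) ^ 2) / ((t : ℂ) - z) + z := by
    field_simp
    ring
  rw [h]
  refine (norm_add_le _ _).trans (add_le_add_left ?_ _)
  rw [norm_div]
  refine div_le_div_of_nonneg_left (norm_nonneg _) z.im_pos ?_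
  have := Complex.abs_im_le_norm ((t : ℂ) - z)
  simpa [abs_of_pos z.im_pos] using this

theorem norm_pickKernel (z w : ℍ) (t : ℝ) :
    ‖(1 + (t : ℂ) ^ 2) / (((t : ℂ) - z) * ((t : ℂ) - (starRingEnd ℂ) (w : ℂ)))‖ =
      (1 + t ^ 2) / (‖(t : ℂ) - z‖ * ‖(t : ℂ) - w‖) := by
  have h1 : ‖(t : ℂ) - (starRingEnd ℂ) (w : ℂ)‖ = ‖(t : ℂ) - w‖ := by
    rw [← Complex.norm_conj ((t : ℂ) - w)]
    simp
  have h2 : ‖(1 + (t : ℂ) ^ 2)‖ = 1 + t ^ 2 := by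
    rw [← Complex.norm_of_nonneg (by positivity : (0 : ℝ) ≤ 1 + t ^ 2)]
    simp
  rw [norm_div, norm_mul, h1, h2]

/-- Weighted AM-GM. Keeping `r` free until after integration replaces Cauchy–Schwarz. -/
theorem two_mul_norm_pickKernel_le (z w : ℍ) (t : ℝ) {r : ℝ} (hr : 0 < r) :
    2 * ‖(1 + (t : ℂ) ^ 2) / (((t : ℂ) - z) * ((t : ℂ) - (starRingEnd ℂ) (w : ℂ)))‖ ≤
      r * ((1 + t ^ 2) / Complex.normSq ((t : ℂ) - z)) +
        r⁻¹ * ((1 + t ^ 2) / Complex.normSq ((t : ℂ) - w)) := by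
  rw [norm_pickKernel, Complex.normSq_eq_norm_sq, Complex.normSq_eq_norm_sq]
  have ha : 0 < ‖(t : ℂ) - z‖ := norm_pos_iff.2 (ofReal_sub_coe_ne_zero t z)
  have hb : 0 < ‖(t : ℂ) - w‖ := norm_pos_iff.2 (ofReal_sub_coe_ne_zero t w)
  generalize ‖(t : ℂ) - z‖ = a at *
  generalize ‖(t : ℂ) - w‖ = b at *
  have h : r * ((1 + t ^ 2) / a ^ 2) + r⁻¹ * ((1 + t ^ 2) / b ^ 2) -
      2 * ((1 + t ^ 2) / (a * b)) = (1 + t ^ 2) * r⁻¹ * (r / a - 1 / b) ^ 2 := by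
    field_simp
    ring
  have : 0 ≤ (1 + t ^ 2) * r⁻¹ * (r / a - 1 / b) ^ 2 := by positivity
  linarith

theorem integrable_pickKernel (z w : ℍ) :
    Integrable (fun t : ℝ =>
      (1 + (t : ℂ) ^ 2) / (((t : ℂ) - z) * ((t : ℂ) - (starRingEnd ℂ) (w : ℂ)))) μ := by
  refine Integrable.mono' ((integrable_poissonDensity μ z).add (integrable_poissonDensity μ w))
    (Continuous.aestronglyMeasurable <| Continuous.div (by fun_prop) (by fun_prop) fun t =>
      mul_ne_zero (ofReal_sub_coe_ne_zero t z) (ofReal_sub_conj_coe_ne_zero t w))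
    (ae_of_all _ fun t => ?_)
  have := two_mul_norm_pickKernel_le z w t one_pos
  have h0 := norm_nonneg
    ((1 + (t : ℂ) ^ 2) / (((t : ℂ) - z) * ((t : ℂ) - (starRingEnd ℂ) (w : ℂ))))
  simp only [Pi.add_apply]
  linarith

theorem two_mul_norm_integral_pickKernel_le (z w : ℍ) {r : ℝ} (hr : 0 < r) :
    2 * ‖∫ t : ℝ, (1 + (t : ℂ) ^ 2) /
        (((t : ℂ) - z) * ((t : ℂ) - (starRingEnd ℂ) (w : ℂ))) ∂μ‖ ≤
      r * poissonMass μ z + r⁻¹ * poissonMass μ w := by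
  calc _ ≤ 2 * ∫ t : ℝ, ‖(1 + (t : ℂ) ^ 2) /
        (((t : ℂ) - z) * ((t : ℂ) - (starRingEnd ℂ) (w : ℂ)))‖ ∂μ := by
        gcongr
        exact norm_integral_le_integral_norm _
    _ = ∫ t : ℝ, 2 * ‖(1 + (t : ℂ) ^ 2) /
        (((t : ℂ) - z) * ((t : ℂ) - (starRingEnd ℂ) (w : ℂ)))‖ ∂μ := by
        rw [integral_const_mul]
    _ ≤ ∫ t : ℝ, r * ((1 + t ^ 2) / Complex.normSq ((t : ℂ) - z)) +
        r⁻¹ * ((1 + t ^ 2) / Complex.normSq ((t : ℂ) - w)) ∂μ :=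
        integral_mono ((integrable_pickKernel μ z w).norm.const_mul 2)
          (((integrable_poissonDensity μ z).const_mul r).add
            ((integrable_poissonDensity μ w).const_mul r⁻¹))
          fun t => two_mul_norm_pickKernel_le z w t hr
    _ = _ := by
        rw [integral_add ((integrable_poissonDensity μ z).const_mul r)
            ((integrable_poissonDensity μ w).const_mul r⁻¹), integral_const_mul,
          integral_const_mul, poissonMass, poissonMass]

theorem herglotzKernel_im (t : ℝ) (z : ℍ) :
    ((1 + (t : ℂ) * (z : ℂ)) / ((t : ℂ) - (z : ℂ))).im =
      z.im * ((1 + t ^ 2) / Complex.normSq ((t : ℂ) - z)) := by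
  have := (normSq_ofReal_sub_coe_pos t z).ne'
  rw [Complex.div_im]
  simp
  field_simp
  ring

end Integrability

/-! ### Imaginary parts and Schwarz–Pick from the representation. -/

section Representation

variable {f : ℍ → ℍ} {β : ℝ} {μ : Measure ℝ} [IsFiniteMeasure μ]

theorem HasParabolicRepresentation.im_apply (hrep : HasParabolicRepresentation f β μ) (z : ℍ) :
    (f z).im = z.im * (1 + poissonMass μ z) := by
  have h := congrArg Complex.im (hrep z)
  have h2 : (∫ t : ℝ, (1 + (t : ℂ) * (z : ℂ)) / ((t : ℂ) - (z : ℂ)) ∂μ).im =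
      z.im * poissonMass μ z := by
    rw [poissonMass, ← integral_const_mul]
    simp only [← herglotzKernel_im]
    exact (integral_im (integrable_herglotzKernel μ z)).symm
  rw [Complex.add_im, Complex.add_im, h2] at h
  simp at h
  rw [h]
  ring

theorem HasParabolicRepresentation.sub_conj (hrep : HasParabolicRepresentation f β μ)
    (z w : ℍ) :
    (f z : ℂ) - (starRingEnd ℂ) (f w : ℂ) = ((z : ℂ) - (starRingEnd ℂ) (w : ℂ)) *
      (1 + ∫ t : ℝ, (1 + (t : ℂ) ^ 2) /
        (((t : ℂ) - z) * ((t : ℂ) - (starRingEnd ℂ) (w : ℂ))) ∂μ) := by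
  rw [hrep z, hrep w, mul_add, ← integral_const_mul]
  have : (∫ t : ℝ, ((z : ℂ) - (starRingEnd ℂ) (w : ℂ)) * ((1 + (t : ℂ) ^ 2) /
        (((t : ℂ) - z) * ((t : ℂ) - (starRingEnd ℂ) (w : ℂ)))) ∂μ) =
      (∫ t : ℝ, (1 + (t : ℂ) * (z : ℂ)) / ((t : ℂ) - (z : ℂ)) ∂μ) -
        (starRingEnd ℂ) (∫ t : ℝ, (1 + (t : ℂ) * (w : ℂ)) / ((t : ℂ) - (w : ℂ)) ∂μ) := by
    rw [← integral_conj, ← integral_sub (integrable_herglotzKernel μ z)]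
    · refine integral_congr_ae (ae_of_all _ fun t => ?_)
      have h1 := ofReal_sub_coe_ne_zero t z
      have h2 := ofReal_sub_conj_coe_ne_zero t w
      simp only [map_div₀, map_add, map_sub, map_mul, map_one, Complex.conj_ofReal]
      field_simp
      ring
    · exact (Complex.conjCLE.toContinuousLinearMap.integrable_comp
        (integrable_herglotzKernel μ w))
  rw [this]
  simp only [map_add, Complex.conj_ofReal]
  ring

/-- The cosh of the distance is governed by |z - conj w|² / (Im z Im w). Applying `f` multiplies
this quotient by |1 + K|² / ((1 + A)(1 + B)), which is at most 1. -/
theorem HasParabolicRepresentation.dist_apply_le (hrep : HasParabolicRepresentation f β μ)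
    (z w : ℍ) : dist (f z) (f w) ≤ dist z w := by
  set K : ℂ := ∫ t : ℝ, (1 + (t : ℂ) ^ 2) /
    (((t : ℂ) - z) * ((t : ℂ) - (starRingEnd ℂ) (w : ℂ))) ∂μ with hK
  have hA := poissonMass_nonneg μ z
  have hB := poissonMass_nonneg μ w
  set A := poissonMass μ z with hAdef
  set B := poissonMass μ w with hBdef
  have hKle : ‖1 + K‖ ≤ √(1 + A) * √(1 + B) := by
    have ha : 0 < √(1 + A) := Real.sqrt_pos.2 (by linarith)
    have hb : 0 < √(1 + B) := Real.sqrt_pos.2 (by linarith)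
    -- This ratio minimises r(1 + A) + (1 + B)/r; the excess r + 1/r ≥ 2 then absorbs the 1 in 1 +
    -- K.
    have hr : 0 < √(1 + B) / √(1 + A) := div_pos hb ha
    have h1 := two_mul_norm_integral_pickKernel_le μ z w hr
    rw [← hK, ← hAdef, ← hBdef, inv_div] at h1
    have h2 : 2 ≤ √(1 + B) / √(1 + A) + √(1 + A) / √(1 + B) := by
      rw [div_add_div _ _ ha.ne' hb.ne', le_div_iff₀ (mul_pos ha hb)]
      nlinarith [sq_nonneg (√(1 + A) - √(1 + B))]
    have h3 : √(1 + B) / √(1 + A) * (1 + A) = √(1 + A) * √(1 + B) := by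
      rw [div_mul_eq_mul_div, div_eq_iff ha.ne']
      nlinarith [Real.mul_self_sqrt (by linarith : 0 ≤ 1 + A)]
    have h4 : √(1 + A) / √(1 + B) * (1 + B) = √(1 + A) * √(1 + B) := by
      rw [div_mul_eq_mul_div, div_eq_iff hb.ne', mul_assoc,
        Real.mul_self_sqrt (by linarith : 0 ≤ 1 + B)]
    have h5 : ‖1 + K‖ ≤ 1 + ‖K‖ := by simpa using norm_add_le (1 : ℂ) K
    nlinarith
  have hsq : ‖1 + K‖ ^ 2 ≤ (1 + A) * (1 + B) := by
    calc _ ≤ (√(1 + A) * √(1 + B)) ^ 2 := by gcongr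
      _ = _ := by rw [mul_pow, Real.sq_sqrt (by linarith), Real.sq_sqrt (by linarith)]
  have key : ∀ a b : ℍ, Real.cosh (dist a b) =
      ‖(a : ℂ) - (starRingEnd ℂ) (b : ℂ)‖ ^ 2 / (2 * (a.im * b.im)) - 1 := by
    intro a b
    have h1 := a.im_pos
    have h2 := b.im_pos
    rw [UpperHalfPlane.cosh_dist, dist_eq_norm, ← Complex.normSq_eq_norm_sq,
      ← Complex.normSq_eq_norm_sq, Complex.normSq_apply, Complex.normSq_apply]
    simp
    field_simp
    ring
  suffices h : Real.cosh (dist (f z) (f w)) ≤ Real.cosh (dist z w) by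
    simpa only [abs_of_nonneg dist_nonneg] using Real.cosh_le_cosh.1 h
  rw [key, key, hrep.sub_conj, ← hK, hrep.im_apply, hrep.im_apply, ← hAdef, ← hBdef]
  have h1 := z.im_pos
  have h2 := w.im_pos
  gcongr ?_ - 1
  rw [div_le_div_iff₀ (by positivity) (by positivity), norm_mul, mul_pow]
  have : 0 ≤ ‖(z : ℂ) - (starRingEnd ℂ) (w : ℂ)‖ ^ 2 * (2 * (z.im * w.im)) := by positivity
  nlinarith [mul_le_mul_of_nonneg_left hsq this]

end Representation

/-! ### Horizontal displacement for symmetric measures. -/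

section Symmetric

variable {μ : Measure ℝ}

theorem IsSymmetricMeasure.map_neg (hμ : IsSymmetricMeasure μ) :
    μ.map (MeasurableEquiv.neg ℝ) = μ := by
  ext A hA
  rw [MeasurableEquiv.map_apply, hμ A hA]
  rfl

theorem IsSymmetricMeasure.integral_comp_neg (hμ : IsSymmetricMeasure μ) {E : Type*}
    [NormedAddCommGroup E] [NormedSpace ℝ E] (g : ℝ → E) :
    ∫ t, g (-t) ∂μ = ∫ t, g t ∂μ := by
  conv_rhs => rw [← hμ.map_neg, integral_map_equiv]
  rfl

theorem IsSymmetricMeasure.integrable_comp_neg (hμ : IsSymmetricMeasure μ) {E : Type*}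
    [NormedAddCommGroup E] {g : ℝ → E} (hg : Integrable g μ) :
    Integrable (fun t => g (-t)) μ := by
  rw [← hμ.map_neg, integrable_map_equiv] at hg
  exact hg

/-- Pairing t with -t makes Re z a factor. Over a common denominator the two sides then differ only
in t² - |z|² against t² + |z|². -/
theorem abs_herglotzKernel_re_add_neg_le (t : ℝ) (z : ℍ) :
    |((1 + (t : ℂ) * (z : ℂ)) / ((t : ℂ) - (z : ℂ))).re +
        ((1 + ((-t : ℝ) : ℂ) * (z : ℂ)) / (((-t : ℝ) : ℂ) - (z : ℂ))).re| ≤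
      |z.re| * ((1 + t ^ 2) / Complex.normSq ((t : ℂ) - z) +
        (1 + (-t) ^ 2) / Complex.normSq (((-t : ℝ) : ℂ) - z)) := by
  have hre : ∀ s : ℝ, ((1 + (s : ℂ) * (z : ℂ)) / ((s : ℂ) - (z : ℂ))).re =
      (1 + s ^ 2) * (s - z.re) / ((s - z.re) ^ 2 + z.im ^ 2) - s := by
    intro s
    have h := (normSq_ofReal_sub_coe_pos s z).ne'
    rw [normSq_ofReal_sub_coe] at h
    rw [Complex.div_re, normSq_ofReal_sub_coe]
    simp
    field_simp
    ring
  have h1 : 0 < (t - z.re) ^ 2 + z.im ^ 2 := by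
    have := z.im_pos
    positivity
  have h2 : 0 < (-t - z.re) ^ 2 + z.im ^ 2 := by
    have := z.im_pos
    positivity
  rw [hre, hre, normSq_ofReal_sub_coe, normSq_ofReal_sub_coe]
  have e1 : (1 + t ^ 2) * (t - z.re) / ((t - z.re) ^ 2 + z.im ^ 2) - t +
      ((1 + (-t) ^ 2) * (-t - z.re) / ((-t - z.re) ^ 2 + z.im ^ 2) - -t) =
      z.re * (2 * (1 + t ^ 2) * (t ^ 2 - z.re ^ 2 - z.im ^ 2) /
        (((t - z.re) ^ 2 + z.im ^ 2) * ((-t - z.re) ^ 2 + z.im ^ 2))) := by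
    field_simp
    ring
  have e2 : (1 + t ^ 2) / ((t - z.re) ^ 2 + z.im ^ 2) +
      (1 + (-t) ^ 2) / ((-t - z.re) ^ 2 + z.im ^ 2) =
      2 * (1 + t ^ 2) * (t ^ 2 + z.re ^ 2 + z.im ^ 2) /
        (((t - z.re) ^ 2 + z.im ^ 2) * ((-t - z.re) ^ 2 + z.im ^ 2)) := by
    field_simp
    ring
  rw [e1, e2, abs_mul, abs_div, abs_of_pos (mul_pos h1 h2), abs_mul,
    abs_of_pos (by positivity : 0 < 2 * (1 + t ^ 2))]
  gcongr
  rw [abs_le]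
  constructor <;> nlinarith [sq_nonneg t, sq_nonneg z.re, sq_nonneg z.im]

variable [IsFiniteMeasure μ] {f : ℍ → ℍ} {β : ℝ}

theorem HasParabolicRepresentation.re_apply (hrep : HasParabolicRepresentation f β μ) (z : ℍ) :
    (f z).re = z.re + β +
      ∫ t : ℝ, ((1 + (t : ℂ) * (z : ℂ)) / ((t : ℂ) - (z : ℂ))).re ∂μ := by
  have h := congrArg Complex.re (hrep z)
  have h2 : (∫ t : ℝ, (1 + (t : ℂ) * (z : ℂ)) / ((t : ℂ) - (z : ℂ)) ∂μ).re =
      ∫ t : ℝ, ((1 + (t : ℂ) * (z : ℂ)) / ((t : ℂ) - (z : ℂ))).re ∂μ :=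
    (integral_re (integrable_herglotzKernel μ z)).symm
  rw [Complex.add_re, Complex.add_re, h2] at h
  simpa using h

theorem HasParabolicRepresentation.abs_re_apply_sub_le (hrep : HasParabolicRepresentation f β μ)
    (hμ : IsSymmetricMeasure μ) (z : ℍ) :
    |(f z).re - z.re - β| ≤ |z.re| * poissonMass μ z := by
  set k : ℝ → ℝ := fun t => ((1 + (t : ℂ) * (z : ℂ)) / ((t : ℂ) - (z : ℂ))).re with hk
  set q : ℝ → ℝ := fun t => (1 + t ^ 2) / Complex.normSq ((t : ℂ) - z) with hq
  have hki : Integrable k μ := (integrable_herglotzKernel μ z).re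
  have hqi : Integrable q μ := integrable_poissonDensity μ z
  have hki' := hμ.integrable_comp_neg hki
  have hqi' := hμ.integrable_comp_neg hqi
  have e1 : 2 * ∫ t, k t ∂μ = ∫ t, (k t + k (-t)) ∂μ := by
    rw [integral_add hki hki', hμ.integral_comp_neg k, two_mul]
  have e2 : 2 * poissonMass μ z = ∫ t, (q t + q (-t)) ∂μ := by
    rw [integral_add hqi hqi', hμ.integral_comp_neg q, two_mul]
    rfl
  have h : |∫ t, (k t + k (-t)) ∂μ| ≤ |z.re| * ∫ t, (q t + q (-t)) ∂μ := by
    rw [← integral_const_mul]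
    refine (abs_integral_le_integral_abs).trans (integral_mono (hki.add hki').abs
      ((hqi.add hqi').const_mul _) fun t => abs_herglotzKernel_re_add_neg_le t z)
  rw [← e1, ← e2, abs_mul, abs_two] at h
  rw [hrep.re_apply z]
  have e3 : z.re + β + ∫ t, k t ∂μ - z.re - β = ∫ t, k t ∂μ := by ring
  rw [e3]
  linarith

end Symmetric

/-! ### Monotonicity along orbits; unbounded height implies zero step. -/

section Orbits

variable {μ : Measure ℝ} [IsFiniteMeasure μ] {f : ℍ → ℍ} {β : ℝ}

theorem HasParabolicRepresentation.im_le_im_apply (hrep : HasParabolicRepresentation f β μ)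
    (z : ℍ) : z.im ≤ (f z).im := by
  rw [hrep.im_apply]
  nlinarith [mul_nonneg z.im_pos.le (poissonMass_nonneg μ z)]

theorem HasParabolicRepresentation.monotone_im_iterate
    (hrep : HasParabolicRepresentation f β μ) (z : ℍ) : Monotone fun n : ℕ => (f^[n] z).im := by
  refine monotone_nat_of_le_succ fun n => ?_
  rw [Function.iterate_succ_apply']
  exact hrep.im_le_im_apply _

theorem HasParabolicRepresentation.dist_iterate_le
    (hrep : HasParabolicRepresentation f β μ) (z w : ℍ) (n : ℕ) :
    dist (f^[n] z) (f^[n] w) ≤ dist z w := by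
  induction n with
  | zero => simp
  | succ n ih =>
    rw [Function.iterate_succ_apply', Function.iterate_succ_apply']
    exact (hrep.dist_apply_le _ _).trans ih

theorem HasParabolicRepresentation.antitone_dist_iterate
    (hrep : HasParabolicRepresentation f β μ) (z : ℍ) :
    Antitone fun n : ℕ => dist (f^[n + 1] z) (f^[n] z) := by
  refine antitone_nat_of_succ_le fun n => ?_
  rw [Function.iterate_succ_apply' f (n + 1), Function.iterate_succ_apply' f n]
  exact hrep.dist_apply_le _ _

/-- Two orbits stay within distance `dist z w`, so their heights are comparable up to the factor
`exp (dist z w)`. -/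
theorem HasParabolicRepresentation.tendsto_im_iterate
    (hrep : HasParabolicRepresentation f β μ) {z : ℍ}
    (h : Tendsto (fun n : ℕ => (f^[n] z).im) atTop atTop) (w : ℍ) :
    Tendsto (fun n : ℕ => (f^[n] w).im) atTop atTop := by
  refine tendsto_atTop_mono (fun n => ?_) (h.atTop_div_const (Real.exp_pos (dist z w)))
  rw [div_le_iff₀ (Real.exp_pos _)]
  refine (UpperHalfPlane.im_le_im_mul_exp_dist _ (f^[n] w)).trans ?_
  have := (f^[n] w).im_pos
  gcongr
  exact hrep.dist_iterate_le z w n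

theorem HasDenjoyWolffPointInfinity.tendsto_norm_iterate (h : HasDenjoyWolffPointInfinity f)
    (z : ℍ) : Tendsto (fun n : ℕ => ‖(f^[n] z : ℂ)‖) atTop atTop :=
  tendsto_atTop.2 fun R => (h {z} isCompact_singleton R).mono fun _ hn => hn z rfl

theorem pseudoHyperbolicDist_eq_tanh (z w : ℍ) :
    pseudoHyperbolicDist z w = Real.tanh (dist z w / 2) := by
  rw [UpperHalfPlane.tanh_half_dist, pseudoHyperbolicDist, dist_eq_norm, dist_eq_norm]

theorem tendsto_pseudoHyperbolicDist_iff {u v : ℕ → ℍ} :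
    Tendsto (fun n => pseudoHyperbolicDist (u n) (v n)) atTop (𝓝 0) ↔
      Tendsto (fun n => dist (u n) (v n)) atTop (𝓝 0) := by
  simp only [pseudoHyperbolicDist_eq_tanh]
  constructor
  · intro h
    have h1 : ContinuousAt Real.artanh 0 := by
      unfold Real.artanh
      refine ContinuousAt.log (ContinuousAt.sqrt ?_) (by simp)
      exact ContinuousAt.div (by fun_prop) (by fun_prop) (by simp)
    have h2 := (h1.tendsto.comp h).const_mul 2
    simpa [Function.comp_def, Real.artanh_tanh, mul_div_cancel₀] using h2
  · intro h
    have h1 : Continuous fun x : ℝ => Real.tanh (x / 2) := by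
      simp only [Real.tanh_eq_sinh_div_cosh]
      exact Continuous.div (by fun_prop) (by fun_prop) fun x => (Real.cosh_pos _).ne'
    simpa [Function.comp_def] using (h1.tendsto 0).comp h

/-- Along a non-tangential sequence tending to `∞` the hyperbolic displacement of `f` vanishes. -/
theorem IsParabolicAtInfinity.tendsto_dist_apply (hf : IsParabolicAtInfinity f)
    (him : ∀ z, z.im ≤ (f z).im) {u : ℕ → ℍ}
    (hu : Tendsto (fun n => ‖(u n : ℂ)‖) atTop atTop) {C : ℝ} (hC : 0 < C)
    (hre : ∀ᶠ n in atTop, |(u n).re| ≤ C * (u n).im) :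
    Tendsto (fun n => dist (f (u n)) (u n)) atTop (𝓝 0) := by
  have h1 : Tendsto (fun n => (u n : ℂ) / (f (u n) : ℂ)) atTop (𝓝 1) :=
    (hf.multiplier_eq_one C hC).comp
      (tendsto_inf.2 ⟨tendsto_comap_iff.2 hu, tendsto_principal.2 hre⟩)
  -- In the sector |z| ≤ (C + 1) Im z, so a small relative displacement is small compared with the
  -- height.
  have h2 : Tendsto (fun n => (C + 1) * ‖((u n : ℂ) / (f (u n) : ℂ))⁻¹ - 1‖) atTop (𝓝 0) := by
    simpa using (((h1.inv₀ one_ne_zero).sub_const 1).norm).const_mul (C + 1)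
  refine squeeze_zero' (Eventually.of_forall fun n => dist_nonneg) ?_ h2
  filter_upwards [hre] with n hn
  have hy := (u n).im_pos
  have hz : (u n : ℂ) ≠ 0 := (u n).ne_zero
  have hnorm : ‖(u n : ℂ)‖ ≤ (C + 1) * (u n).im := by
    have := Complex.norm_le_abs_re_add_abs_im (u n : ℂ)
    simp only [UpperHalfPlane.coe_re, UpperHalfPlane.coe_im, abs_of_pos hy] at this
    linarith
  have hsqrt : (u n).im ≤ √((f (u n)).im * (u n).im) :=
    Real.le_sqrt_of_sq_le (by nlinarith [him (u n)])
  calc dist (f (u n)) (u n) ≤ dist (f (u n) : ℂ) (u n) / √((f (u n)).im * (u n).im) :=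
        UpperHalfPlane.dist_le_dist_coe_div_sqrt _ _
    _ ≤ dist (f (u n) : ℂ) (u n) / (u n).im := by gcongr
    _ = ‖(u n : ℂ)‖ * ‖((u n : ℂ) / (f (u n) : ℂ))⁻¹ - 1‖ / (u n).im := by
        rw [← norm_mul, dist_eq_norm, inv_div, mul_sub, mul_div_cancel₀ _ hz, mul_one]
    _ ≤ _ := by
        rw [div_le_iff₀ hy]
        nlinarith [norm_nonneg (((u n : ℂ) / (f (u n) : ℂ))⁻¹ - 1)]

theorem IsParabolicAtInfinity.tendsto_dist_iterate_of_abs_re_le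
    (hf : IsParabolicAtInfinity f) (him : ∀ z, z.im ≤ (f z).im) {z : ℍ} {C : ℝ} (hC : 0 < C)
    (hre : ∀ᶠ n : ℕ in atTop, |(f^[n] z).re| ≤ C * (f^[n] z).im) :
    Tendsto (fun n : ℕ => dist (f^[n + 1] z) (f^[n] z)) atTop (𝓝 0) := by
  simp only [Function.iterate_succ_apply']
  exact hf.tendsto_dist_apply him (hf.denjoyWolff.tendsto_norm_iterate z) hC hre

/-- If `β = 0`, the orbit of `i` stays on the imaginary axis. -/
theorem HasParabolicRepresentation.re_iterate_I (hrep : HasParabolicRepresentation f 0 μ)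
    (hμ : IsSymmetricMeasure μ) (n : ℕ) : (f^[n] UpperHalfPlane.I).re = 0 := by
  induction n with
  | zero => simp
  | succ n ih =>
    have := hrep.abs_re_apply_sub_le hμ (f^[n] UpperHalfPlane.I)
    rw [Function.iterate_succ_apply']
    simpa [ih] using this

theorem IsParabolicAtInfinity.tendsto_im_iterate_I (hf : IsParabolicAtInfinity f)
    (hrep : HasParabolicRepresentation f 0 μ) (hμ : IsSymmetricMeasure μ) :
    Tendsto (fun n : ℕ => (f^[n] UpperHalfPlane.I).im) atTop atTop := by
  refine (hf.denjoyWolff.tendsto_norm_iterate UpperHalfPlane.I).congr fun n => ?_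
  have h := hrep.re_iterate_I hμ n
  have : (f^[n] UpperHalfPlane.I : ℂ) = ((f^[n] UpperHalfPlane.I).im : ℂ) * Complex.I := by
    apply Complex.ext <;> simp [h]
  rw [this, norm_mul, Complex.norm_I, mul_one, Complex.norm_real,
    Real.norm_of_nonneg (UpperHalfPlane.im_pos _).le]

/-- If the imaginary parts along an orbit tend to infinity, then the hyperbolic step
tends to zero. -/
theorem IsParabolicAtInfinity.tendsto_dist_iterate (hf : IsParabolicAtInfinity f)
    (hrep : HasParabolicRepresentation f β μ) (hμ : IsSymmetricMeasure μ) {z : ℍ}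
    (h : Tendsto (fun n : ℕ => (f^[n] z).im) atTop atTop) :
    Tendsto (fun n : ℕ => dist (f^[n + 1] z) (f^[n] z)) atTop (𝓝 0) := by
  have hbdd : BddBelow (Set.range fun n : ℕ => dist (f^[n + 1] z) (f^[n] z)) :=
    ⟨0, by rintro _ ⟨n, rfl⟩; exact dist_nonneg⟩
  have hlim := tendsto_atTop_ciInf (hrep.antitone_dist_iterate z) hbdd
  set s := ⨅ n : ℕ, dist (f^[n + 1] z) (f^[n] z) with hs
  have hs0 : 0 ≤ s := le_ciInf fun n => dist_nonneg
  rcases hs0.eq_or_lt with hs0 | hs0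
  · rwa [← hs0] at hlim
  -- With limiting step s > 0, every Euclidean step is at least κ times the current height.
  set κ := 1 - Real.exp (-s) with hκ
  have hκ0 : 0 < κ := by
    rw [hκ, sub_pos, Real.exp_lt_one_iff]
    linarith
  set c := 2 * |β| / κ with hc
  set v : ℕ → ℝ := fun n => 1 + |(f^[n] z).re| / (f^[n] z).im with hv
  obtain ⟨N, hN⟩ := eventually_atTop.1 (h.eventually_ge_atTop (2 * |β| / κ))
  -- The ratio |x|/y grows only through β. The correcting exponential turns `v` into a nonincreasing
  -- quantity, which keeps the orbit in a sector.
  have hstep : ∀ n, N ≤ n → v (n + 1) * Real.exp (c / (f^[n + 1] z).im) ≤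
      v n * Real.exp (c / (f^[n] z).im) := by
    intro n hn
    have hβ := hN n hn
    have hdist : s ≤ dist (f^[n + 1] z) (f^[n] z) := ciInf_le hbdd n
    simp only [hv]
    rw [Function.iterate_succ_apply'] at hdist ⊢
    set w := f^[n] z with hw
    have hA := poissonMass_nonneg μ w
    have hx := hrep.abs_re_apply_sub_le hμ w
    have hlow : w.im * κ ≤ ‖(f w : ℂ) - w‖ := by
      rw [← dist_eq_norm]
      refine le_trans ?_ (UpperHalfPlane.le_dist_coe (f w) w)
      have := w.im_pos
      rw [hκ]
      gcongr
    have hup := Complex.norm_le_abs_re_add_abs_im ((f w : ℂ) - w)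
    simp only [Complex.sub_re, Complex.sub_im, UpperHalfPlane.coe_re,
      UpperHalfPlane.coe_im] at hup
    have him := hrep.im_apply w
    have hy := w.im_pos
    have hy' := (f w).im_pos
    set A := poissonMass μ w with hAdef
    set x := w.re
    set y := w.im
    set x' := (f w).re
    set y' := (f w).im
    rw [div_le_iff₀ hκ0] at hβ
    have hxx : |x' - x| ≤ |β| + |x| * A := by
      have : x' - x = (x' - x - β) + β := by ring
      rw [this]
      exact (abs_add_le _ _).trans (by linarith)
    have hx' : |x'| ≤ |β| + |x| * (1 + A) := by
      have : x' = (x' - x) + x := by ring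
      rw [this]
      exact (abs_add_le _ _).trans (by linarith)
    have hyy : |y' - y| = y * A := by
      rw [him, show y * (1 + A) - y = y * A by ring, abs_of_nonneg (by positivity)]
    -- Once y ≥ 2|β|/κ, the drift β accounts for at most half of the step; the rest must come from
    -- A.
    have hAlow : κ / 2 ≤ A * (1 + |x| / y) := by
      have : κ / 2 * y ≤ A * (1 + |x| / y) * y := by
        have e : A * (1 + |x| / y) * y = A * y + |x| * A := by field_simp
        rw [e]
        linarith
      exact le_of_mul_le_mul_right this hy
    have h1 : 1 + |x'| / y' ≤ (1 + |x| / y) * (1 + c * (A / y')) := by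
      have e1 : |x'| / y' ≤ |β| / y' + |x| / y := by
        have : |β| / y' + |x| / y = (|β| + |x| * (1 + A)) / y' := by
          rw [him]
          have : 1 + A ≠ 0 := by positivity
          field_simp
        rw [this]
        gcongr
      have e2 : |β| / y' ≤ (1 + |x| / y) * (c * (A / y')) := by
        have : (1 + |x| / y) * (c * (A / y')) = (2 * (A * (1 + |x| / y)) / κ) * (|β| / y') := by
          rw [hc]
          field_simp
        rw [this]
        refine le_mul_of_one_le_left (by positivity) ?_
        rw [le_div_iff₀ hκ0]
        linarith
      linarith
    -- Since y' = y(1 + A), the term cA/y' telescopes as c/y - c/y'.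
    have h2 : 1 + c * (A / y') ≤ Real.exp (c / y - c / y') := by
      have : c / y - c / y' = c * (A / y') := by
        rw [him]
        have : 1 + A ≠ 0 := by positivity
        field_simp
        ring
      rw [this, add_comm]
      exact Real.add_one_le_exp _
    calc (1 + |x'| / y') * Real.exp (c / y')
        ≤ ((1 + |x| / y) * Real.exp (c / y - c / y')) * Real.exp (c / y') := by
          gcongr
          exact h1.trans (by gcongr)
      _ = _ := by rw [mul_assoc, ← Real.exp_add, sub_add_cancel]
  set W := v N * Real.exp (c / (f^[N] z).im) with hW
  have hbound : ∀ n, N ≤ n → v n * Real.exp (c / (f^[n] z).im) ≤ W := by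
    intro n hn
    induction n, hn using Nat.le_induction with
    | base => exact le_rfl
    | succ n hn ih => exact (hstep n hn).trans ih
  have hv1 : ∀ n, 1 ≤ v n := fun n =>
    le_add_of_nonneg_right (div_nonneg (abs_nonneg _) (UpperHalfPlane.im_pos _).le)
  have hWpos : 0 < W := mul_pos (one_pos.trans_le (hv1 N)) (Real.exp_pos _)
  refine hf.tendsto_dist_iterate_of_abs_re_le hrep.im_le_im_apply hWpos ?_
  filter_upwards [eventually_ge_atTop N] with n hn
  rw [← div_le_iff₀ (UpperHalfPlane.im_pos _)]
  have h1 : v n ≤ W := by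
    refine le_trans ?_ (hbound n hn)
    refine le_mul_of_one_le_right (zero_le_one.trans (hv1 n)) (Real.one_le_exp ?_)
    have := (f^[n] z).im_pos
    positivity
  simp only [hv] at h1
  linarith

end Orbits

/-! ### Infinite second moment: every orbit has unbounded height. -/

section InfiniteMoment

variable {μ : Measure ℝ} [IsFiniteMeasure μ] {f : ℍ → ℍ} {β : ℝ}

/-- Whichever of t and -t has the sign of Re z lies at distance ||t| - |Re z|| from it; its term
alone suffices. -/
theorem sq_le_poissonDensity_add_neg {t R Y : ℝ} {z : ℍ} (hY : z.im ≤ Y)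
    (hR : |(|t| - |z.re|)| ≤ R) :
    t ^ 2 * (R ^ 2 + Y ^ 2)⁻¹ ≤ (1 + t ^ 2) / Complex.normSq ((t : ℂ) - z) +
      (1 + (-t) ^ 2) / Complex.normSq (((-t : ℝ) : ℂ) - z) := by
  have hy := z.im_pos
  have hsq : (|t| - |z.re|) ^ 2 ≤ R ^ 2 := sq_le_sq' (abs_le.1 hR).1 (abs_le.1 hR).2
  have hysq : z.im ^ 2 ≤ Y ^ 2 := by gcongr
  have key : ∀ s : ℝ, s ^ 2 = t ^ 2 → (s - z.re) ^ 2 = (|t| - |z.re|) ^ 2 →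
      t ^ 2 * (R ^ 2 + Y ^ 2)⁻¹ ≤ (1 + s ^ 2) / Complex.normSq ((s : ℂ) - z) := by
    intro s hs h
    rw [← div_eq_mul_inv, normSq_ofReal_sub_coe, h, hs]
    gcongr
    linarith
  have h1 := poissonDensity_nonneg t z
  have h2 := poissonDensity_nonneg (-t) z
  rcases le_total 0 (t * z.re) with h | h
  · refine (key t rfl ?_).trans (le_add_of_nonneg_right h2)
    have : |t| * |z.re| = t * z.re := by rw [← abs_mul, abs_of_nonneg h]
    nlinarith [sq_abs t, sq_abs z.re]
  · refine (key (-t) (neg_sq t) ?_).trans (le_add_of_nonneg_left h1)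
    have : |t| * |z.re| = -(t * z.re) := by rw [← abs_mul, abs_of_nonpos h]
    nlinarith [sq_abs t, sq_abs z.re]

/-- At the first index where `ξ` reaches τ, the overshoot is at most one jump, or at most `ξ 0` if
that index is 0. -/
theorem exists_abs_sub_le_of_tendsto_atTop {ξ : ℕ → ℝ} {L : ℝ} (hξ : Tendsto ξ atTop atTop)
    (hL : ∀ n, ξ (n + 1) - ξ n ≤ L) {τ : ℝ} (hτ : 0 ≤ τ) :
    ∃ n, |τ - ξ n| ≤ max L (ξ 0) := by
  classical
  have hex : ∃ n, τ ≤ ξ n := (hξ.eventually_ge_atTop τ).exists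
  obtain ⟨n, hn, hmin⟩ : ∃ n, τ ≤ ξ n ∧ ∀ m < n, ¬ τ ≤ ξ m :=
    ⟨Nat.find hex, Nat.find_spec hex, fun m hm => Nat.find_min hex hm⟩
  refine ⟨n, ?_⟩
  rw [abs_of_nonpos (by linarith)]
  rcases n with _ | n
  · exact le_max_of_le_right (by linarith)
  · have := hmin n n.lt_succ_self
    exact le_max_of_le_left (by linarith [hL n])

theorem HasParabolicRepresentation.sum_poissonMass_iterate_le
    (hrep : HasParabolicRepresentation f β μ) (z : ℍ) (n : ℕ) :
    z.im * ∑ k ∈ Finset.range n, poissonMass μ (f^[k] z) ≤ (f^[n] z).im - z.im := by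
  have h := Finset.sum_range_sub (fun k => (f^[k] z).im) n
  simp only [Function.iterate_zero, id_eq] at h
  rw [← h, Finset.mul_sum]
  refine Finset.sum_le_sum fun k _ => ?_
  have h1 : z.im ≤ (f^[k] z).im := hrep.monotone_im_iterate z (Nat.zero_le k)
  rw [Function.iterate_succ_apply', hrep.im_apply]
  nlinarith [mul_le_mul_of_nonneg_right h1 (poissonMass_nonneg μ (f^[k] z))]

theorem HasParabolicRepresentation.tendsto_im_iterate_or_bounded
    (hrep : HasParabolicRepresentation f β μ) (z : ℍ) :
    Tendsto (fun n : ℕ => (f^[n] z).im) atTop atTop ∨ ∃ Y, ∀ n, (f^[n] z).im ≤ Y := by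
  refine (tendsto_atTop_of_monotone (hrep.monotone_im_iterate z)).imp_right ?_
  rintro ⟨l, hl⟩
  exact ⟨l, (hrep.monotone_im_iterate z).ge_of_tendsto hl⟩

/-- If heights stay below Y, |Re| tends to infinity with bounded upward jumps, so every |t| is
within a fixed R of some orbit value. The symmetrised densities then sum to at least c t², although
their integrals have a finite sum by telescoping heights. -/
theorem IsParabolicAtInfinity.tendsto_im_iterate_of_lintegral_eq_top
    (hf : IsParabolicAtInfinity f) (hrep : HasParabolicRepresentation f β μ)
    (hμ : IsSymmetricMeasure μ) (hmom : ∫⁻ t : ℝ, ENNReal.ofReal (t ^ 2) ∂μ = ⊤) (z : ℍ) :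
    Tendsto (fun n : ℕ => (f^[n] z).im) atTop atTop := by
  refine (hrep.tendsto_im_iterate_or_bounded z).resolve_right ?_
  rintro ⟨Y, hY⟩
  have hY0 : 0 < Y := (f^[0] z).im_pos.trans_le (hY 0)
  have hre : Tendsto (fun n : ℕ => |(f^[n] z).re|) atTop atTop := by
    refine tendsto_atTop_mono (fun n => ?_)
      (tendsto_atTop_add_const_right _ (-Y) (hf.denjoyWolff.tendsto_norm_iterate z))
    have := Complex.norm_le_abs_re_add_abs_im (f^[n] z : ℂ)
    simp only [UpperHalfPlane.coe_re, UpperHalfPlane.coe_im,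
      abs_of_pos (UpperHalfPlane.im_pos _)] at this
    linarith [hY n]
  have hL : ∀ n, |(f^[n + 1] z).re| - |(f^[n] z).re| ≤ Y * (Real.exp (dist (f z) z) - 1) := by
    intro n
    have h1 := abs_sub_abs_le_abs_sub (f^[n + 1] z).re (f^[n] z).re
    have h2 := Complex.abs_re_le_norm ((f^[n + 1] z : ℂ) - f^[n] z)
    rw [Complex.sub_re, ← dist_eq_norm] at h2
    have h3 := UpperHalfPlane.dist_coe_le (f^[n + 1] z) (f^[n] z)
    have h4 : dist (f^[n + 1] z) (f^[n] z) ≤ dist (f z) z := by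
      simpa using hrep.antitone_dist_iterate z (Nat.zero_le n)
    have h5 : 0 ≤ Real.exp (dist (f^[n + 1] z) (f^[n] z)) - 1 :=
      sub_nonneg.2 (Real.one_le_exp dist_nonneg)
    have h6 : (f^[n] z).im * (Real.exp (dist (f^[n + 1] z) (f^[n] z)) - 1) ≤
        Y * (Real.exp (dist (f z) z) - 1) :=
      mul_le_mul (hY n) (by gcongr) h5 hY0.le
    exact h1.trans (h2.trans (h3.trans h6))
  obtain ⟨R, hR⟩ : ∃ R, ∀ t : ℝ, ∃ n, |(|t| - |(f^[n] z).re|)| ≤ R :=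
    ⟨_, fun t => exists_abs_sub_le_of_tendsto_atTop hre hL (abs_nonneg t)⟩
  set c := (R ^ 2 + Y ^ 2)⁻¹ with hc
  have hc0 : 0 < c := by positivity
  set q : ℕ → ℝ → ℝ := fun n t => (1 + t ^ 2) / Complex.normSq ((t : ℂ) - f^[n] z) with hq
  have hqi : ∀ n, Integrable (q n) μ := fun n => integrable_poissonDensity μ _
  have hqi' : ∀ n, Integrable (fun t => q n (-t)) μ := fun n => hμ.integrable_comp_neg (hqi n)
  have hadd : ∀ n, Integrable (fun t => q n t + q n (-t)) μ := fun n => (hqi n).add (hqi' n)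
  have hint : ∀ n, ∫⁻ t, ENNReal.ofReal (q n t + q n (-t)) ∂μ =
      ENNReal.ofReal (2 * poissonMass μ (f^[n] z)) := by
    intro n
    rw [← ofReal_integral_eq_lintegral_ofReal (hadd n), integral_add (hqi n) (hqi' n),
      hμ.integral_comp_neg (q n), two_mul]
    · rfl
    · exact ae_of_all _ fun t =>
        add_nonneg (poissonDensity_nonneg t _) (poissonDensity_nonneg (-t) _)
  have hle : ∫⁻ t : ℝ, ENNReal.ofReal (t ^ 2) * ENNReal.ofReal c ∂μ ≤
      ∫⁻ t, ∑' n, ENNReal.ofReal (q n t + q n (-t)) ∂μ := by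
    refine lintegral_mono fun t => ?_
    obtain ⟨n, hn⟩ := hR t
    refine le_trans ?_ (ENNReal.le_tsum n)
    rw [← ENNReal.ofReal_mul (sq_nonneg t)]
    exact ENNReal.ofReal_le_ofReal (sq_le_poissonDensity_add_neg (hY n) hn)
  rw [lintegral_mul_const' _ _ ENNReal.ofReal_ne_top, hmom,
    ENNReal.top_mul (ENNReal.ofReal_pos.2 hc0).ne', lintegral_tsum fun n =>
      (hadd n).aestronglyMeasurable.aemeasurable.ennreal_ofReal] at hle
  simp only [hint] at hle
  have hfin : ∑' n, ENNReal.ofReal (2 * poissonMass μ (f^[n] z)) ≤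
      ENNReal.ofReal (2 * (Y / z.im)) := by
    refine ENNReal.tsum_le_of_sum_range_le fun n => ?_
    rw [← ENNReal.ofReal_sum_of_nonneg fun k _ =>
      mul_nonneg zero_le_two (poissonMass_nonneg μ _), ← Finset.mul_sum]
    refine ENNReal.ofReal_le_ofReal (mul_le_mul_of_nonneg_left ?_ zero_le_two)
    rw [le_div_iff₀ z.im_pos]
    have := hrep.sum_poissonMass_iterate_le z n
    linarith [hY n, z.im_pos]
  exact absurd (hle.trans hfin) (not_le.2 ENNReal.ofReal_lt_top)

end InfiniteMoment

/-! ### Finite second moment: a nonzero drift keeps heights bounded. -/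

section FiniteMoment

/-- Mean value inequality: 1 + x² ≤ 3(1 + a²) whenever |x - a| ≤ 1. -/
theorem div_le_arctan_add_sub (a : ℝ) {h : ℝ} (h0 : 0 ≤ h) (h1 : h ≤ 1) :
    h / (3 * (1 + a ^ 2)) ≤ Real.arctan (a + h) - Real.arctan a := by
  have := (convex_Icc a (a + h)).mul_sub_le_image_sub_of_le_deriv
    Real.continuous_arctan.continuousOn Real.differentiable_arctan.differentiableOn
    (C := (3 * (1 + a ^ 2))⁻¹) (fun x hx => ?_) a ⟨le_rfl, by linarith⟩ (a + h)
    ⟨by linarith, le_rfl⟩ (by linarith)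
  · rw [add_sub_cancel_left] at this
    rwa [div_eq_inv_mul]
  · rw [interior_Icc] at hx
    simp only [Real.deriv_arctan, one_div]
    have h2 : (x - a) ^ 2 ≤ 1 := by
      rw [sq_le_one_iff_abs_le_one, abs_le]
      constructor <;> linarith [hx.1, hx.2]
    gcongr
    nlinarith [sq_nonneg (x - 2 * a)]

/-- A uniform bound for sums of Poisson kernels at height `Y` over `δ`-separated points. -/
theorem sum_poissonKernel_le_of_separated {ξ : ℕ → ℝ} {δ Y : ℝ} (hδ : 0 < δ) (hY : δ ≤ Y)
    {n : ℕ} (hξ : ∀ k < n, ξ k + δ ≤ ξ (k + 1)) (τ : ℝ) :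
    ∑ k ∈ Finset.range n, Y / ((τ - ξ k) ^ 2 + Y ^ 2) ≤ 3 * Real.pi / δ := by
  have hY0 : 0 < Y := hδ.trans_le hY
  -- Each kernel value is charged to an increment of arctan; the increments telescope to at most π.
  have hstep : ∀ k ∈ Finset.range n, Y / ((τ - ξ k) ^ 2 + Y ^ 2) ≤ 3 / δ *
      (Real.arctan ((ξ (k + 1) - τ) / Y) - Real.arctan ((ξ k - τ) / Y)) := by
    intro k hk
    have h1 := div_le_arctan_add_sub ((ξ k - τ) / Y) (div_pos hδ hY0).le
      ((div_le_one hY0).2 hY)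
    have h2 : Real.arctan ((ξ k - τ) / Y + δ / Y) ≤ Real.arctan ((ξ (k + 1) - τ) / Y) := by
      refine Real.arctan_strictMono.monotone ?_
      rw [← add_div]
      gcongr
      linarith [hξ k (Finset.mem_range.1 hk)]
    have h3 : Y / ((τ - ξ k) ^ 2 + Y ^ 2) =
        3 / δ * (δ / Y / (3 * (1 + ((ξ k - τ) / Y) ^ 2))) := by
      have : (τ - ξ k) ^ 2 + Y ^ 2 ≠ 0 := by positivity
      have : Y ^ 2 + (ξ k - τ) ^ 2 ≠ 0 := by positivity
      field_simp
      ring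
    rw [h3]
    gcongr
    linarith
  refine (Finset.sum_le_sum hstep).trans ?_
  rw [← Finset.mul_sum, Finset.sum_range_sub fun k => Real.arctan ((ξ k - τ) / Y)]
  have h1 := Real.arctan_lt_pi_div_two ((ξ n - τ) / Y)
  have h2 := Real.neg_pi_div_two_lt_arctan ((ξ 0 - τ) / Y)
  rw [mul_div_right_comm]
  gcongr
  linarith

variable {μ : Measure ℝ} [IsFiniteMeasure μ] {f : ℍ → ℍ} {β : ℝ}

theorem integrable_one_add_sq (hmom : ∫⁻ t : ℝ, ENNReal.ofReal (t ^ 2) ∂μ < ⊤) :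
    Integrable (fun t : ℝ => 1 + t ^ 2) μ := by
  refine (integrable_const 1).add ⟨by fun_prop, ?_⟩
  rwa [hasFiniteIntegral_iff_ofReal (ae_of_all _ fun t => sq_nonneg t)]

theorem norm_cauchyKernel_le (t : ℝ) (z : ℍ) :
    ‖(1 + (t : ℂ) ^ 2) / ((t : ℂ) - z)‖ ≤ (1 + t ^ 2) / z.im := by
  have h2 : ‖(1 + (t : ℂ) ^ 2)‖ = 1 + t ^ 2 := by
    rw [← Complex.norm_of_nonneg (by positivity : (0 : ℝ) ≤ 1 + t ^ 2)]
    simp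
  rw [norm_div, h2]
  refine div_le_div_of_nonneg_left (by positivity) z.im_pos ?_
  have := Complex.abs_im_le_norm ((t : ℂ) - z)
  simpa [abs_of_pos z.im_pos] using this

theorem continuous_cauchyKernel (z : ℍ) :
    Continuous fun t : ℝ => (1 + (t : ℂ) ^ 2) / ((t : ℂ) - z) :=
  Continuous.div (by fun_prop) (by fun_prop) fun t => ofReal_sub_coe_ne_zero t z

/-- The two kernels differ by t, which is now integrable and has mean zero by symmetry. -/
theorem HasParabolicRepresentation.apply_eq_of_finite_moment
    (hrep : HasParabolicRepresentation f β μ) (hμ : IsSymmetricMeasure μ)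
    (hmom : ∫⁻ t : ℝ, ENNReal.ofReal (t ^ 2) ∂μ < ⊤) (z : ℍ) :
    (f z : ℂ) = z + β + ∫ t : ℝ, (1 + (t : ℂ) ^ 2) / ((t : ℂ) - z) ∂μ := by
  have hm := integrable_one_add_sq hmom
  have h1 : Integrable (fun t : ℝ => (1 + (t : ℂ) ^ 2) / ((t : ℂ) - z)) μ :=
    (hm.div_const z.im).mono' (continuous_cauchyKernel z).aestronglyMeasurable
      (ae_of_all _ fun t => norm_cauchyKernel_le t z)
  have h2 : Integrable (fun t : ℝ => (t : ℂ)) μ := by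
    refine hm.mono' (by fun_prop) (ae_of_all _ fun t => ?_)
    rw [Complex.norm_real, Real.norm_eq_abs, abs_le]
    constructor <;> nlinarith [sq_nonneg (t - 1), sq_nonneg (t + 1)]
  have h3 : ∫ t : ℝ, (t : ℂ) ∂μ = 0 := by
    have := hμ.integral_comp_neg fun t : ℝ => (t : ℂ)
    simp only [Complex.ofReal_neg, integral_neg] at this
    exact CharZero.neg_eq_self_iff.1 this
  rw [hrep z, ← sub_zero (∫ t : ℝ, (1 + (t : ℂ) ^ 2) / ((t : ℂ) - z) ∂μ), ← h3,
    ← integral_sub h1 h2]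
  congr 1
  refine integral_congr_ae (ae_of_all _ fun t => ?_)
  have := ofReal_sub_coe_ne_zero t z
  field_simp
  ring

theorem HasParabolicRepresentation.norm_apply_sub_le
    (hrep : HasParabolicRepresentation f β μ) (hμ : IsSymmetricMeasure μ)
    (hmom : ∫⁻ t : ℝ, ENNReal.ofReal (t ^ 2) ∂μ < ⊤) (z : ℍ) :
    ‖(f z : ℂ) - z - β‖ ≤ (∫ t, (1 + t ^ 2) ∂μ) / z.im := by
  rw [hrep.apply_eq_of_finite_moment hμ hmom z, add_assoc, add_sub_cancel_left,
    add_sub_cancel_left, ← integral_div]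
  exact norm_integral_le_of_norm_le ((integrable_one_add_sq hmom).div_const _)
    (ae_of_all _ fun t => norm_cauchyKernel_le t z)

theorem HasParabolicRepresentation.exists_bounded_im_iterate
    (hrep : HasParabolicRepresentation f β μ) (hμ : IsSymmetricMeasure μ)
    (hmom : ∫⁻ t : ℝ, ENNReal.ofReal (t ^ 2) ∂μ < ⊤) (hβ : β ≠ 0) :
    ∃ (z : ℍ) (B : ℝ), ∀ n, (f^[n] z).im ≤ B := by
  set M := ∫ t, (1 + t ^ 2) ∂μ with hM
  have hM0 : 0 ≤ M := integral_nonneg fun t => by positivity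
  set δ := |β| / 2 with hδ
  have hδ0 : 0 < δ := by positivity
  -- The first bound permits the separated-sum estimate. The second caps the total gain in height by
  -- Y, and also gives M / Y ≤ δ, so each real step in the direction of β is at least |β| - δ = δ.
  set Y := max δ (6 * Real.pi * M / δ) with hY
  have hYδ : δ ≤ Y := le_max_left _ _
  have hY0 : 0 < Y := hδ0.trans_le hYδ
  have hYM : 6 * Real.pi * M / δ ≤ Y := le_max_right _ _
  have hMY : M / Y ≤ δ := by
    rw [div_le_iff₀ hδ0] at hYM
    rw [div_le_iff₀ hY0]
    nlinarith [Real.pi_gt_three, mul_nonneg hM0 (by linarith [Real.pi_gt_three] :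
      0 ≤ 6 * Real.pi - 1)]
  set z : ℍ := UpperHalfPlane.mk ⟨0, Y⟩ hY0 with hz
  have hzim : z.im = Y := rfl
  have hYle : ∀ n, Y ≤ (f^[n] z).im := fun n => hrep.monotone_im_iterate z (Nat.zero_le n)
  obtain ⟨σ, hσ, hσβ⟩ : ∃ σ : ℝ, σ ^ 2 = 1 ∧ σ * β = |β| := by
    rcases le_total 0 β with h | h
    · exact ⟨1, by norm_num, by rw [one_mul, abs_of_nonneg h]⟩
    · exact ⟨-1, by norm_num, by rw [neg_one_mul, abs_of_nonpos h]⟩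
  have hσabs : |σ| = 1 := by
    rw [← abs_one, ← sq_eq_sq_iff_abs_eq_abs, hσ, one_pow]
  have hsep : ∀ n, σ * (f^[n] z).re + δ ≤ σ * (f^[n + 1] z).re := by
    intro n
    rw [Function.iterate_succ_apply']
    set w := f^[n] z with hw
    have h1 := Complex.abs_re_le_norm ((f w : ℂ) - w - β)
    have h2 := hrep.norm_apply_sub_le hμ hmom w
    have h3 : M / w.im ≤ M / Y := div_le_div_of_nonneg_left hM0 hY0 (hYle n)
    simp only [Complex.sub_re, UpperHalfPlane.coe_re, Complex.ofReal_re] at h1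
    have h4 : |σ * ((f w).re - w.re - β)| ≤ δ := by
      rw [abs_mul, hσabs, one_mul]
      exact h1.trans (h2.trans (h3.trans hMY))
    have h5 := (abs_le.1 h4).1
    rw [mul_sub, mul_sub, hσβ] at h5
    linarith
  refine ⟨z, 2 * Y, fun n => ?_⟩
  induction n using Nat.strong_induction_on with
  | _ n ih =>
  -- The Poisson density decreases with height, so lowering the orbit to height Y only increases it
  -- and reduces to kernels of one fixed height.
  set w : ℕ → ℍ := fun k => UpperHalfPlane.mk ⟨(f^[k] z).re, Y⟩ hY0 with hw
  have hwre : ∀ k, (w k).re = (f^[k] z).re := fun k => rfl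
  have hwim : ∀ k, (w k).im = Y := fun k => rfl
  have hterm : ∀ k < n, (f^[k + 1] z).im - (f^[k] z).im ≤ 2 * Y * poissonMass μ (w k) := by
    intro k hk
    rw [Function.iterate_succ_apply', hrep.im_apply, mul_add, mul_one, add_sub_cancel_left]
    refine mul_le_mul (ih k hk) ?_ (poissonMass_nonneg _ _) (by positivity)
    refine integral_mono (integrable_poissonDensity μ _) (integrable_poissonDensity μ _)
      fun t => ?_
    simp only [normSq_ofReal_sub_coe, hwre, hwim]
    have := hYle k
    gcongr
  have hsum : ∑ k ∈ Finset.range n, 2 * Y * poissonMass μ (w k) ≤ Y := by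
    calc ∑ k ∈ Finset.range n, 2 * Y * poissonMass μ (w k)
        = ∫ t, ∑ k ∈ Finset.range n,
            2 * Y * ((1 + t ^ 2) / Complex.normSq ((t : ℂ) - w k)) ∂μ := by
          rw [integral_finsetSum _ fun k _ => (integrable_poissonDensity μ (w k)).const_mul _]
          simp only [integral_const_mul, poissonMass]
      _ ≤ ∫ t, (1 + t ^ 2) * (6 * Real.pi / δ) ∂μ := by
          refine integral_mono (integrable_finsetSum _ fun k _ =>
            (integrable_poissonDensity μ (w k)).const_mul _)
            ((integrable_one_add_sq hmom).mul_const _) fun t => ?_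
          have h1 := sum_poissonKernel_le_of_separated hδ0 hYδ
            (ξ := fun k => σ * (f^[k] z).re) (n := n) (fun k _ => hsep k) (σ * t)
          have h2 : ∑ k ∈ Finset.range n,
              2 * Y * ((1 + t ^ 2) / Complex.normSq ((t : ℂ) - w k)) =
              2 * (1 + t ^ 2) * ∑ k ∈ Finset.range n,
                Y / ((σ * t - σ * (f^[k] z).re) ^ 2 + Y ^ 2) := by
            rw [Finset.mul_sum]
            refine Finset.sum_congr rfl fun k _ => ?_
            rw [normSq_ofReal_sub_coe, hwre, hwim, ← mul_sub, mul_pow, hσ, one_mul]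
            ring
          simp only [h2]
          calc _ ≤ 2 * (1 + t ^ 2) * (3 * Real.pi / δ) := by gcongr
            _ = _ := by ring
      _ = 6 * Real.pi * M / δ := by
          rw [integral_mul_const]
          ring
      _ ≤ Y := hYM
  have htel := Finset.sum_range_sub (fun k => (f^[k] z).im) n
  have := Finset.sum_le_sum fun k hk => hterm k (Finset.mem_range.1 hk)
  rw [htel] at this
  simp only [Function.iterate_zero, id_eq] at this
  linarith

theorem HasParabolicRepresentation.not_tendsto_im_iterate
    (hrep : HasParabolicRepresentation f β μ) (hμ : IsSymmetricMeasure μ)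
    (hmom : ∫⁻ t : ℝ, ENNReal.ofReal (t ^ 2) ∂μ < ⊤) (hβ : β ≠ 0) (z : ℍ) :
    ¬ Tendsto (fun n : ℕ => (f^[n] z).im) atTop atTop := by
  intro h
  obtain ⟨w, B, hB⟩ := hrep.exists_bounded_im_iterate hμ hmom hβ
  obtain ⟨n, hn⟩ := ((hrep.tendsto_im_iterate h w).eventually_gt_atTop B).exists
  exact (hB n).not_gt hn

/-- Dominated convergence: the Cauchy kernel vanishes pointwise as the orbit escapes, and the
starting height supplies the dominating function. -/
theorem IsParabolicAtInfinity.tendsto_apply_sub (hf : IsParabolicAtInfinity f)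
    (hrep : HasParabolicRepresentation f β μ) (hμ : IsSymmetricMeasure μ)
    (hmom : ∫⁻ t : ℝ, ENNReal.ofReal (t ^ 2) ∂μ < ⊤) (z : ℍ) :
    Tendsto (fun n : ℕ => (f^[n + 1] z : ℂ) - f^[n] z) atTop (𝓝 β) := by
  have h : Tendsto (fun n : ℕ => ∫ t : ℝ, (1 + (t : ℂ) ^ 2) / ((t : ℂ) - f^[n] z) ∂μ) atTop
      (𝓝 (∫ _ : ℝ, (0 : ℂ) ∂μ)) := by
    refine tendsto_integral_of_dominated_convergence (fun t => (1 + t ^ 2) / z.im)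
      (fun n => (continuous_cauchyKernel _).aestronglyMeasurable)
      ((integrable_one_add_sq hmom).div_const _) (fun n => ae_of_all _ fun t => ?_)
      (ae_of_all _ fun t => ?_)
    · refine (norm_cauchyKernel_le t _).trans ?_
      exact div_le_div_of_nonneg_left (by positivity) z.im_pos
        (hrep.monotone_im_iterate z (Nat.zero_le n))
    · simp only [div_eq_mul_inv]
      rw [← mul_zero (1 + (t : ℂ) ^ 2)]
      refine (tendsto_inv₀_cobounded.comp (tendsto_norm_atTop_iff_cobounded.1 ?_)).const_mul _
      refine tendsto_atTop_mono (fun n => ?_) (tendsto_atTop_add_const_right _ (-‖(t : ℂ)‖)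
        (hf.denjoyWolff.tendsto_norm_iterate z))
      have := norm_sub_norm_le (f^[n] z : ℂ) t
      rw [norm_sub_rev] at this
      linarith
  rw [integral_zero] at h
  have h2 := h.const_add (β : ℂ)
  rw [add_zero] at h2
  refine h2.congr fun n => ?_
  rw [Function.iterate_succ_apply', hrep.apply_eq_of_finite_moment hμ hmom]
  ring

/-- At bounded height a vanishing hyperbolic step forces a vanishing Euclidean step, but the
Euclidean steps tend to β. -/
theorem IsParabolicAtInfinity.not_hasZeroHyperbolicStep (hf : IsParabolicAtInfinity f)
    (hrep : HasParabolicRepresentation f β μ) (hμ : IsSymmetricMeasure μ)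
    (hmom : ∫⁻ t : ℝ, ENNReal.ofReal (t ^ 2) ∂μ < ⊤) (hβ : β ≠ 0) :
    ¬ HasZeroHyperbolicStep f := by
  rintro ⟨z, hz⟩
  rw [tendsto_pseudoHyperbolicDist_iff] at hz
  obtain ⟨Y, hY⟩ := (hrep.tendsto_im_iterate_or_bounded z).resolve_left
    (hrep.not_tendsto_im_iterate hμ hmom hβ z)
  have h1 : Tendsto (fun n : ℕ => (f^[n + 1] z : ℂ) - f^[n] z) atTop (𝓝 0) := by
    have h2 : Tendsto (fun n : ℕ => Y * (Real.exp (dist (f^[n + 1] z) (f^[n] z)) - 1)) atTop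
        (𝓝 0) := by
      simpa using (((Real.continuous_exp.tendsto 0).comp hz).sub_const 1).const_mul Y
    refine squeeze_zero_norm (fun n => ?_) h2
    rw [← dist_eq_norm]
    refine (UpperHalfPlane.dist_coe_le _ _).trans ?_
    have := sub_nonneg.2 (Real.one_le_exp (dist_nonneg (x := f^[n + 1] z) (y := f^[n] z)))
    have := hY n
    gcongr
  have := tendsto_nhds_unique h1 (hf.tendsto_apply_sub hrep hμ hmom z)
  exact hβ (by exact_mod_cast this.symm)

end FiniteMoment

/-! ### Assembly of the dichotomy. -/

theorem mainTheorem4 (f : ℍ → ℍ) (hf : IsParabolicAtInfinity f)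
    (β : ℝ) (μ : Measure ℝ) [IsFiniteMeasure μ]
    (hrep : HasParabolicRepresentation f β μ) (hμ : IsSymmetricMeasure μ) :
    (∫⁻ t : ℝ, ENNReal.ofReal (t ^ 2) ∂μ < ⊤ → (HasZeroHyperbolicStep f ↔ β = 0)) ∧
    (∫⁻ t : ℝ, ENNReal.ofReal (t ^ 2) ∂μ = ⊤ → HasZeroHyperbolicStep f) ∧
    (∀ z : ℍ, HasZeroHyperbolicStep f ↔
      Tendsto (fun n : ℕ => (f^[n] z).im) atTop atTop) := by
  have hstep : ∀ z : ℍ, Tendsto (fun n : ℕ => (f^[n] z).im) atTop atTop →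
      HasZeroHyperbolicStep f := fun z hz =>
    ⟨z, tendsto_pseudoHyperbolicDist_iff.2 (hf.tendsto_dist_iterate hrep hμ hz)⟩
  have hzero : β = 0 → ∀ z : ℍ, Tendsto (fun n : ℕ => (f^[n] z).im) atTop atTop := by
    rintro rfl
    exact hrep.tendsto_im_iterate (hf.tendsto_im_iterate_I hrep hμ)
  have htop := hf.tendsto_im_iterate_of_lintegral_eq_top hrep hμ
  have hfin : ∫⁻ t : ℝ, ENNReal.ofReal (t ^ 2) ∂μ < ⊤ → HasZeroHyperbolicStep f → β = 0 :=
    fun hmom h => by_contra fun hβ => hf.not_hasZeroHyperbolicStep hrep hμ hmom hβ h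
  refine ⟨fun hmom => ⟨hfin hmom, fun h => hstep UpperHalfPlane.I (hzero h _)⟩,
    fun hmom => hstep UpperHalfPlane.I (htop hmom _), fun z => ⟨fun h => ?_, hstep z⟩⟩
  rcases eq_or_ne (∫⁻ t : ℝ, ENNReal.ofReal (t ^ 2) ∂μ) ⊤ with hmom | hmom
  · exact htop hmom z
  · exact hzero (hfin hmom.lt_top h) z
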